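/- For a nonnegative function $f$ on $\mathbb{R}^d$ with finite second moments and $\int f>0$, let $\mathrm{Cov}(f)$ be the $d\times d$ matrix with entries $\frac{\int x_ix_jf(x)\,dx}{\int f}-\frac{\int x_if(x)\,dx\,\int x_jf(x)\,dx}{(\int f)^2}$. A convex body $K\subset\mathbb{R}^d$ (a compact convex set with nonempty interior) is called isotropic if $\mathrm{Cov}(\mathbf{1}_K)=\sigma^2 I_d$ for some $\sigma>0$; its barycenter need not be the origin and its volume $|K|$ is not normalized. Proposition. Let $d\ge 1$ be an integer and let $v_0>0$ (for instance $v_0=1$). There is a constant $M>0$, depending only on $d$ and the volume threshold $v_0$, such that for every isotropic convex body $K$ in $\mathbb{R}^d$ with $|K|\ge v_0$, $$\left|\frac{\#(K\cap\mathbb{Z}^d)}{|K|}-1\right|\le\frac{M}{|K|^{1/d}}.$$ In particular, fixing $v_0=1$, there is a constant $M_d$ depending only on $d$ for which this holds for all isotropic convex bodies of volume at least $1$. If $d=1$ the condition $|K|\ge v_0$ is not needed. -/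

import Mathlib

open MeasureTheory

noncomputable section

/-- The covariance (inertia) matrix of a function `f` on `ℝ^d`, with entries
`∫ xᵢ xⱼ f / ∫ f - (∫ xᵢ f) (∫ xⱼ f) / (∫ f)²`. -/
def covMatrix {d : ℕ} (f : EuclideanSpace ℝ (Fin d) → ℝ) : Matrix (Fin d) (Fin d) ℝ :=
  Matrix.of fun i j =>
    (∫ x, x i * x j * f x) / (∫ x, f x)
      - ((∫ x, x i * f x) * (∫ x, x j * f x)) / (∫ x, f x) ^ 2

/-- A function on `ℝ^d` is isotropic if its covariance matrix is `σ² I_d` for some `σ > 0`. -/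
def IsIsotropic {d : ℕ} (f : EuclideanSpace ℝ (Fin d) → ℝ) : Prop :=
  ∃ σ : ℝ, 0 < σ ∧ covMatrix f = σ ^ 2 • (1 : Matrix (Fin d) (Fin d) ℝ)

/-- A convex body is isotropic if it has nonempty interior (Mathlib's `ConvexBody` is only a
nonempty compact convex set) and its indicator function is isotropic. -/
def IsIsotropicBody {d : ℕ} (K : ConvexBody (EuclideanSpace ℝ (Fin d))) : Prop :=
  (interior (K : Set (EuclideanSpace ℝ (Fin d)))).Nonempty ∧
    IsIsotropic ((K : Set (EuclideanSpace ℝ (Fin d))).indicator fun _ => (1 : ℝ))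

/-- The lattice `ℤ^d` inside `ℝ^d`. -/
def integerLattice (d : ℕ) : Set (EuclideanSpace ℝ (Fin d)) :=
  {x | ∀ i, ∃ n : ℤ, x i = n}

end

/-! Unit cubes with lower corner in `K ∩ ℤ^d` have total volume equal to the lattice count. If `K`
contains a ball of radius `r` about `b`, moving points by at most `√d` is absorbed by dilating `K`
about `b` by `1 ± √d/r`, so the count over `|K|` is at most `(1 + t)^d` with `t = √d/r`, and at
least `(1 - t)^d` when `t ≤ 1` (`ncard_lattice_bounds`). Isotropy makes `r` comparable to
`|K|^(1/d)`: the ball of radius `σ/2^(d+1)` about the barycentre lies in `K`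
(`closedBall_subset_of_moments`), while `|K|` is at most a constant times `σ^d`
(`volume_le_of_second_moments`). The volume threshold bounds `t`, so that `(1 + t)^d - 1 = O(t)`;
for `d = 1` this is automatic. -/

theorem ball_subset_homothety_thickening {E : Type*} [NormedAddCommGroup E] [NormedSpace ℝ E]
    {K : Set E} (hK : Convex ℝ K) {b : E} {r ρ : ℝ} (hr : 0 < r) (hρ : 0 < ρ)
    (hball : Metric.closedBall b r ⊆ K) {x y : E} (hy : y ∈ K) (hxy : ‖x - y‖ ≤ ρ) :
    x ∈ AffineMap.homothety b (1 + ρ / r) '' K := by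
  have ht : 0 < ρ / r := div_pos hρ hr
  have h1 : (0 : ℝ) < 1 + ρ / r := by positivity
  -- The displacement rescaled to length at most `r` lands in the ball; averaging it with `y` in
  -- proportion `ρ/r : 1` gives the preimage of `x`.
  have hw : b + (ρ / r)⁻¹ • (x - y) ∈ K := by
    apply hball
    rw [mem_closedBall_iff_norm, add_sub_cancel_left, norm_smul, Real.norm_of_nonneg (by positivity)]
    calc (ρ / r)⁻¹ * ‖x - y‖ ≤ (ρ / r)⁻¹ * ρ := by gcongr
      _ = r := by field_simp
  refine ⟨(1 + ρ / r)⁻¹ • y + ((1 + ρ / r)⁻¹ * (ρ / r)) • (b + (ρ / r)⁻¹ • (x - y)),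
    hK hy hw (by positivity) (by positivity) (by field_simp), ?_⟩
  rw [AffineMap.homothety_apply, vsub_eq_sub, vadd_eq_add]
  match_scalars <;> field_simp <;> ring

theorem mem_of_near_homothety {E : Type*} [NormedAddCommGroup E] [NormedSpace ℝ E]
    {K : Set E} (hK : Convex ℝ K) {b : E} {r ρ : ℝ} (hr : 0 < r) (hρ : 0 < ρ) (hρr : ρ ≤ r)
    (hball : Metric.closedBall b r ⊆ K) {x y : E}
    (hy : y ∈ AffineMap.homothety b (1 - ρ / r) '' K) (hxy : ‖x - y‖ ≤ ρ) : x ∈ K := by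
  obtain ⟨z, hz, rfl⟩ := hy
  have ht : 0 < ρ / r := div_pos hρ hr
  have ht1 : ρ / r ≤ 1 := (div_le_one hr).2 hρr
  set y := AffineMap.homothety b (1 - ρ / r) z with hydef
  have hw : b + (ρ / r)⁻¹ • (x - y) ∈ K := by
    apply hball
    rw [mem_closedBall_iff_norm, add_sub_cancel_left, norm_smul, Real.norm_of_nonneg (by positivity)]
    calc (ρ / r)⁻¹ * ‖x - y‖ ≤ (ρ / r)⁻¹ * ρ := by gcongr
      _ = r := by field_simp
  have := hK hz hw (sub_nonneg.2 ht1) ht.le (by ring)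
  convert this using 1
  rw [smul_add, smul_inv_smul₀ ht.ne', hydef, AffineMap.homothety_apply, vsub_eq_sub, vadd_eq_add]
  module

/-! ### Lattice points and unit cubes -/

/-- The coordinatewise floor of a point of `ℝ^d`. -/
noncomputable def floorPoint {d : ℕ} (x : EuclideanSpace ℝ (Fin d)) : Fin d → ℤ := fun i => ⌊x i⌋

/-- An integer vector as a point of Euclidean space. -/
noncomputable def intPoint {d : ℕ} (z : Fin d → ℤ) : EuclideanSpace ℝ (Fin d) := WithLp.toLp 2 fun i => (z i : ℝ)

theorem intPoint_injective (d : ℕ) : Function.Injective (intPoint (d := d)) := by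
  intro z w h
  funext i
  have := congrArg (fun x : EuclideanSpace ℝ (Fin d) => x i) h
  simpa [intPoint] using this

theorem norm_sub_intPoint_floorPoint_le {d : ℕ} (x : EuclideanSpace ℝ (Fin d)) :
    ‖x - intPoint (floorPoint x)‖ ≤ Real.sqrt d := by
  rw [EuclideanSpace.norm_eq]
  apply Real.sqrt_le_sqrt
  calc ∑ i, ‖(x - intPoint (floorPoint x)) i‖ ^ 2 ≤ ∑ i : Fin d, (1 : ℝ) := by
        refine Finset.sum_le_sum fun i _ => ?_
        have h : (x - intPoint (floorPoint x)) i = Int.fract (x i) := rfl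
        rw [h, Real.norm_of_nonneg (Int.fract_nonneg _)]
        exact pow_le_one₀ (Int.fract_nonneg _) (Int.fract_lt_one _).le
    _ = d := by simp

theorem volume_floorPoint_fiber {d : ℕ} (z : Fin d → ℤ) :
    volume {x : EuclideanSpace ℝ (Fin d) | floorPoint x = z} = 1 := by
  have h : {x : EuclideanSpace ℝ (Fin d) | floorPoint x = z} =
      WithLp.ofLp ⁻¹' (Set.univ.pi fun i => Set.Ico (z i : ℝ) (z i + 1)) := by
    ext x
    simp [floorPoint, funext_iff, Int.floor_eq_iff]
  rw [h, (PiLp.volume_preserving_ofLp (Fin d)).measure_preimage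
    (MeasurableSet.univ_pi fun i => measurableSet_Ico).nullMeasurableSet, volume_pi_pi]
  simp

theorem measurable_floorPoint {d : ℕ} : Measurable (floorPoint (d := d)) := by
  unfold floorPoint
  fun_prop

theorem volume_floorPoint_preimage {d : ℕ} (S : Set (Fin d → ℤ)) (hS : S.Finite) :
    volume.real (floorPoint (d := d) ⁻¹' S) = S.ncard := by
  have h : floorPoint (d := d) ⁻¹' S = ⋃ z ∈ hS.toFinset, {x | floorPoint x = z} := by
    ext x; simp
  rw [Measure.real, h, measure_biUnion_finset]
  · simp [volume_floorPoint_fiber, Set.ncard_eq_toFinset_card S hS]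
  · intro z _ w _ hzw
    exact Set.disjoint_left.2 fun x hx hx' => hzw (hx.symm.trans hx')
  · intro z _
    exact measurable_floorPoint (measurableSet_singleton z)

theorem finite_intPoint_preimage {d : ℕ} {K : Set (EuclideanSpace ℝ (Fin d))}
    (hK : Bornology.IsBounded K) : (intPoint ⁻¹' K).Finite := by
  obtain ⟨R, hR⟩ := hK.exists_norm_le
  refine (Set.finite_Icc (fun _ => -⌈R⌉ : Fin d → ℤ) (fun _ => ⌈R⌉)).subset fun z hz => ?_
  have h : ∀ i, |(z i : ℝ)| ≤ ⌈R⌉ := fun i =>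
    ((PiLp.norm_apply_le (intPoint z) i).trans (hR _ hz)).trans (Int.le_ceil R)
  have h' : ∀ i, |z i| ≤ ⌈R⌉ := fun i => by exact_mod_cast h i
  exact ⟨fun i => (abs_le.1 (h' i)).1, fun i => (abs_le.1 (h' i)).2⟩

theorem volume_real_homothety {d : ℕ} (K : Set (EuclideanSpace ℝ (Fin d)))
    (b : EuclideanSpace ℝ (Fin d)) {s : ℝ} (hs : 0 ≤ s) :
    volume.real (AffineMap.homothety b s '' K) = s ^ d * volume.real K := by
  rw [Measure.real, Measure.addHaar_image_homothety, ENNReal.toReal_mul,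
    finrank_euclideanSpace_fin, abs_of_nonneg (by positivity),
    ENNReal.toReal_ofReal (by positivity), Measure.real]

theorem ncard_lattice_bounds {d : ℕ} (hd : 1 ≤ d) {K : Set (EuclideanSpace ℝ (Fin d))}
    (hK : Convex ℝ K) (hKc : IsCompact K) {b : EuclideanSpace ℝ (Fin d)} {r : ℝ} (hr : 0 < r)
    (hball : Metric.closedBall b r ⊆ K) :
    ((intPoint ⁻¹' K).ncard : ℝ) ≤ (1 + √d / r) ^ d * volume.real K ∧
      (√d ≤ r → (1 - √d / r) ^ d * volume.real K ≤ ((intPoint ⁻¹' K).ncard : ℝ)) := by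
  have hρ : 0 < √(d : ℝ) := Real.sqrt_pos.2 (by exact_mod_cast hd)
  rw [← volume_floorPoint_preimage _ (finite_intPoint_preimage hKc.isBounded)]
  have hsub : floorPoint ⁻¹' (intPoint ⁻¹' K) ⊆ AffineMap.homothety b (1 + √d / r) '' K :=
    fun x hx => ball_subset_homothety_thickening hK hr hρ hball hx
      (norm_sub_intPoint_floorPoint_le x)
  have hfin : volume (AffineMap.homothety b (1 + √d / r) '' K) ≠ ⊤ := by
    rw [Measure.addHaar_image_homothety]
    exact ENNReal.mul_ne_top ENNReal.ofReal_ne_top hKc.measure_lt_top.ne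
  constructor
  · rw [← volume_real_homothety K b (by positivity)]
    exact measureReal_mono hsub hfin
  · intro h
    rw [← volume_real_homothety K b (sub_nonneg.2 ((div_le_one hr).2 h))]
    refine measureReal_mono (fun x hx => ?_) (measure_ne_top_of_subset hsub hfin)
    refine mem_of_near_homothety hK hr hρ h hball hx ?_
    rw [norm_sub_rev]
    exact norm_sub_intPoint_floorPoint_le x

/-! ### Moments, inradius and volume of an isotropic body -/

theorem integral_mul_indicator_one {d : ℕ} {K : Set (EuclideanSpace ℝ (Fin d))}
    (hK : MeasurableSet K) (g : EuclideanSpace ℝ (Fin d) → ℝ) :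
    ∫ x, g x * K.indicator (fun _ => (1 : ℝ)) x = ∫ x in K, g x := by
  rw [← integral_indicator hK]
  congr 1 with x
  by_cases hx : x ∈ K <;> simp [hx]

/-- An isotropic compact set has centred first moments about some point `b`, and its
second moments about `b` are those of a multiple of the identity. -/
theorem exists_centred_moments {d : ℕ} {K : Set (EuclideanSpace ℝ (Fin d))} (hK : IsCompact K)
    (hV : 0 < volume.real K) (hiso : IsIsotropic (K.indicator fun _ => (1 : ℝ))) :
    ∃ (b : EuclideanSpace ℝ (Fin d)) (σ : ℝ), 0 < σ ∧
      (∀ i, ∫ x in K, (x - b) i = 0) ∧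
      ∀ i j, ∫ x in K, (x - b) i * (x - b) j = if i = j then σ ^ 2 * volume.real K else 0 := by
  obtain ⟨σ, hσ, h⟩ := hiso
  have hm := hK.measurableSet
  have hint : ∀ g : EuclideanSpace ℝ (Fin d) → ℝ, Continuous g → IntegrableOn g K :=
    fun g hg => hg.continuousOn.integrableOn_compact hK
  set V := volume.real K with hVdef
  have hone : ∫ x, K.indicator (fun _ => (1 : ℝ)) x = V := by
    rw [integral_indicator hm]; simp [hVdef]
  set m : Fin d → ℝ := fun i => ∫ x in K, x i with hmdef
  refine ⟨WithLp.toLp 2 fun i => m i / V, σ, hσ, fun i => ?_, fun i j => ?_⟩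
  · simp only [PiLp.sub_apply]
    rw [integral_sub (hint _ (by fun_prop)) (hint _ (by fun_prop))]
    simp only [integral_const, measureReal_restrict_apply_univ, smul_eq_mul, ← hVdef]
    change m i - V * (m i / V) = 0
    field_simp
    ring
  · have hij := congrFun (congrFun h i) j
    simp only [covMatrix, Matrix.of_apply, integral_mul_indicator_one hm, hone,
      Matrix.smul_apply, Matrix.one_apply, smul_eq_mul, mul_ite, mul_one, mul_zero] at hij
    change _ - m i * m j / V ^ 2 = _ at hij
    have hexp : ∀ x : EuclideanSpace ℝ (Fin d),
        (x - WithLp.toLp 2 fun i => m i / V) i * (x - WithLp.toLp 2 fun i => m i / V) j =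
          x i * x j - (m j / V) * x i - (m i / V) * x j + m i / V * (m j / V) := fun x => by
      simp only [PiLp.sub_apply]; ring
    simp only [hexp]
    rw [integral_add (hint _ (by fun_prop)) (hint _ (by fun_prop)),
      integral_sub (hint _ (by fun_prop)) (hint _ (by fun_prop)),
      integral_sub (hint _ (by fun_prop)) (hint _ (by fun_prop)),
      integral_const_mul, integral_const_mul]
    simp only [integral_const, measureReal_restrict_apply_univ, smul_eq_mul, ← hVdef]
    change _ - m j / V * m i - m i / V * m j + _ = _
    have hsplit : (if i = j then σ ^ 2 * V else 0) = (if i = j then σ ^ 2 else 0) * V := by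
      split_ifs <;> simp
    rw [hsplit, ← hij]
    field_simp
    ring

theorem inner_moments {d : ℕ} {K : Set (EuclideanSpace ℝ (Fin d))} (hK : IsCompact K)
    {b : EuclideanSpace ℝ (Fin d)} {c : ℝ} (h1 : ∀ i, ∫ x in K, (x - b) i = 0)
    (h2 : ∀ i j, ∫ x in K, (x - b) i * (x - b) j = if i = j then c else 0)
    (θ : EuclideanSpace ℝ (Fin d)) :
    ∫ x in K, inner ℝ θ (x - b) = 0 ∧ ∫ x in K, inner ℝ θ (x - b) ^ 2 = c * ‖θ‖ ^ 2 := by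
  have hint : ∀ g : EuclideanSpace ℝ (Fin d) → ℝ, Continuous g → IntegrableOn g K :=
    fun g hg => hg.continuousOn.integrableOn_compact hK
  have hin : ∀ x, inner ℝ θ (x - b) = ∑ i, θ i * (x - b) i := fun x => by
    simp [PiLp.inner_apply, mul_comm]
  constructor
  · simp only [hin]
    rw [integral_finsetSum _ fun i _ => hint _ (by fun_prop)]
    simp only [integral_const_mul, h1, mul_zero, Finset.sum_const_zero]
  · have hsq : ∀ x, inner ℝ θ (x - b) ^ 2 =
        ∑ i, ∑ j, (θ i * θ j) * ((x - b) i * (x - b) j) := fun x => by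
      rw [hin, sq, Finset.sum_mul_sum]
      exact Finset.sum_congr rfl fun i _ => Finset.sum_congr rfl fun j _ => by ring
    simp only [hsq]
    rw [integral_finsetSum _ fun i _ => hint _ (by fun_prop)]
    rw [EuclideanSpace.norm_sq_eq, Finset.mul_sum]
    refine Finset.sum_congr rfl fun i _ => ?_
    rw [integral_finsetSum _ fun j _ => hint _ (by fun_prop)]
    simp only [integral_const_mul, h2, mul_ite, mul_zero, Finset.sum_ite_eq, Finset.mem_univ,
      if_true, Real.norm_eq_abs, sq_abs]
    ring

/-- A convex body cannot be much thinner on one side of its barycentre than its standard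
deviation in that direction. -/
theorem variance_le_of_forall_le {d : ℕ} {K : Set (EuclideanSpace ℝ (Fin d))} (hK : IsCompact K)
    (hconv : Convex ℝ K) (hV : 0 < volume.real K) {θ b : EuclideanSpace ℝ (Fin d)}
    (h1 : ∫ x in K, inner ℝ θ (x - b) = 0) {a s : ℝ}
    (h2 : ∫ x in K, inner ℝ θ (x - b) ^ 2 = s * volume.real K)
    (ha : ∀ x ∈ K, inner ℝ θ (x - b) ≤ a) : 0 ≤ a ∧ s ≤ 2 ^ (d + 1) * a ^ 2 := by
  have hint : ∀ g : EuclideanSpace ℝ (Fin d) → ℝ, Continuous g → IntegrableOn g K :=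
    fun g hg => hg.continuousOn.integrableOn_compact hK
  have hm := hK.measurableSet
  have hne : K.Nonempty := by
    by_contra h
    simp [Set.not_nonempty_iff_eq_empty.1 h] at hV
  obtain ⟨p, hp, hmin⟩ := hK.exists_isMinOn hne
    (f := fun x => inner ℝ θ (x - b)) (by fun_prop)
  set V := volume.real K with hVdef
  set u : EuclideanSpace ℝ (Fin d) → ℝ := fun x => inner ℝ θ (x - b) with hu
  have hmin : ∀ x ∈ K, u p ≤ u x := hmin
  have huc : Continuous u := by fun_prop
  have hInt : ∫ x in K, (a - u x) = a * V := by
    rw [integral_sub (hint _ (by fun_prop)) (hint _ huc), h1]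
    simp [← hVdef, mul_comm]
  have ha0 : 0 ≤ a := by
    have : 0 ≤ ∫ x in K, (a - u x) := setIntegral_nonneg hm fun x hx => sub_nonneg.2 (ha x hx)
    rw [hInt] at this
    exact nonneg_of_mul_nonneg_left this hV
  -- On the half-size copy of `K` about the minimiser `p`, `a - u` is at least half its maximum.
  -- Comparing with `∫ (a - u) = a V` bounds the width `a - u p` by `2^(d+1) a`.
  set L := AffineMap.homothety p (2⁻¹ : ℝ) '' K with hL
  have hLK : L ⊆ K := by
    rintro _ ⟨x, hx, rfl⟩
    have := hconv hx hp (by norm_num : (0 : ℝ) ≤ 2⁻¹) (by norm_num : (0 : ℝ) ≤ 2⁻¹) (by norm_num)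
    convert this using 1
    rw [AffineMap.homothety_apply, vsub_eq_sub, vadd_eq_add]
    module
  have hLm : MeasurableSet L :=
    (hK.image (AffineMap.homothety_continuous p (2⁻¹ : ℝ))).measurableSet
  have hLu : ∀ x ∈ L, (a - u p) / 2 ≤ a - u x := by
    rintro _ ⟨x, hx, rfl⟩
    have hx' := ha x hx
    have : u (AffineMap.homothety p (2⁻¹ : ℝ) x) = (u x + u p) / 2 := by
      simp only [hu]
      rw [← inner_add_right, div_eq_inv_mul, ← real_inner_smul_right]
      congr 1
      rw [AffineMap.homothety_apply, vsub_eq_sub, vadd_eq_add]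
      module
    rw [this]
    change u x ≤ a at hx'
    linarith
  have hlow : (2⁻¹ ^ d * V) * ((a - u p) / 2) ≤ a * V := by
    rw [← volume_real_homothety K p (by norm_num), ← hInt, ← hL]
    calc volume.real L * ((a - u p) / 2) = ∫ x in L, (a - u p) / 2 := by simp
      _ ≤ ∫ x in L, (a - u x) :=
        setIntegral_mono_on (((hint (fun _ => (a - u p) / 2) (by fun_prop)).mono_set hLK))
          ((hint _ (by fun_prop)).mono_set hLK) hLm hLu
      _ ≤ ∫ x in K, (a - u x) := by
        refine setIntegral_mono_set (hint _ (by fun_prop)) ?_ hLK.eventuallyLE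
        exact (ae_restrict_iff' hm).2 (ae_of_all _ fun x hx => sub_nonneg.2 (ha x hx))
  have hwidth : a - u p ≤ 2 ^ (d + 1) * a := by
    rw [inv_pow] at hlow
    have h2d : (0 : ℝ) < 2 ^ d := by positivity
    have : V * (a - u p) ≤ V * (2 ^ (d + 1) * a) := by
      calc V * (a - u p) = 2 ^ (d + 1) * (((2 ^ d)⁻¹ * V) * ((a - u p) / 2)) := by
            rw [pow_succ]; field_simp
        _ ≤ 2 ^ (d + 1) * (a * V) := by gcongr
        _ = _ := by ring
    exact le_of_mul_le_mul_left this hV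
  refine ⟨ha0, ?_⟩
  -- For a centred `u` with values in `[u p, a]`, this integral shows that the variance is at most
  -- `-(u p) a`.
  have hprod : 0 ≤ ∫ x in K, (u x - u p) * (a - u x) :=
    setIntegral_nonneg hm fun x hx =>
      mul_nonneg (sub_nonneg.2 (hmin x hx)) (sub_nonneg.2 (ha x hx))
  have hexp : ∀ x, (u x - u p) * (a - u x) = ((a + u p) * u x - u p * a) - u x ^ 2 :=
    fun x => by ring
  simp only [hexp] at hprod
  rw [integral_sub (hint _ (by fun_prop)) (hint _ (by fun_prop)),
    integral_sub (hint _ (by fun_prop)) (hint _ (by fun_prop)), integral_const_mul, h1, h2]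
    at hprod
  simp only [integral_const, measureReal_restrict_apply_univ, smul_eq_mul, ← hVdef] at hprod
  have hs : s ≤ -(u p) * a := by
    refine le_of_mul_le_mul_right (a := V) ?_ hV
    linarith
  calc s ≤ -(u p) * a := hs
    _ ≤ (2 ^ (d + 1) * a) * a := by gcongr; linarith
    _ = _ := by ring

/-- A ball point outside `K` is separated from it by a hyperplane with normal `θ`, too close to `b`
for the variance `σ² ‖θ‖²` in that direction. -/
theorem closedBall_subset_of_moments {d : ℕ} {K : Set (EuclideanSpace ℝ (Fin d))}
    (hK : IsCompact K) (hconv : Convex ℝ K) (hV : 0 < volume.real K)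
    {b : EuclideanSpace ℝ (Fin d)} {σ : ℝ} (hσ : 0 < σ) (h1 : ∀ i, ∫ x in K, (x - b) i = 0)
    (h2 : ∀ i j, ∫ x in K, (x - b) i * (x - b) j = if i = j then σ ^ 2 * volume.real K else 0) :
    Metric.closedBall b (σ / 2 ^ (d + 1)) ⊆ K := by
  intro y hy
  by_contra hyK
  obtain ⟨f, t, hft, hty⟩ := geometric_hahn_banach_closed_point hconv hK.isClosed hyK
  set θ := (InnerProductSpace.toDual ℝ _).symm f with hθ
  have hf : ∀ x, inner ℝ θ x = f x := fun x => InnerProductSpace.toDual_symm_apply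
  obtain ⟨m1, m2⟩ := inner_moments hK h1 h2 θ
  obtain ⟨ha, hs⟩ := variance_le_of_forall_le hK hconv hV m1 (s := σ ^ 2 * ‖θ‖ ^ 2)
    (a := t - f b) (by rw [m2]; ring) fun x hx => by
      rw [hf, map_sub]; linarith [hft x hx]
  have hcs : t - f b < ‖θ‖ * (σ / 2 ^ (d + 1)) :=
    calc t - f b < inner ℝ θ (y - b) := by rw [hf, map_sub]; linarith
      _ ≤ ‖θ‖ * ‖y - b‖ := real_inner_le_norm _ _
      _ ≤ _ := by gcongr; exact mem_closedBall_iff_norm.1 hy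
  have hpow : (1 : ℝ) ≤ 2 ^ (d + 1) := one_le_pow₀ (by norm_num)
  have : (2 ^ (d + 1) * (t - f b)) ^ 2 < (‖θ‖ * σ) ^ 2 := by
    refine pow_lt_pow_left₀ ?_ (by positivity) two_ne_zero
    calc 2 ^ (d + 1) * (t - f b) < 2 ^ (d + 1) * (‖θ‖ * (σ / 2 ^ (d + 1))) := by gcongr
      _ = ‖θ‖ * σ := by field_simp
  have h4 : 2 ^ (d + 1) * (t - f b) ^ 2 ≤ (2 ^ (d + 1) * (t - f b)) ^ 2 := by
    rw [mul_pow]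
    gcongr
    exact le_self_pow₀ hpow two_ne_zero
  nlinarith

/-- Chebyshev: the mean of `‖x - b‖²` is `d σ²`, so at least half of `K` lies within `√(2d) σ` of
`b`. -/
theorem volume_le_of_second_moments {d : ℕ} (hd : 1 ≤ d) {K : Set (EuclideanSpace ℝ (Fin d))}
    (hK : IsCompact K) {b : EuclideanSpace ℝ (Fin d)} {σ : ℝ} (hσ : 0 < σ)
    (h2 : ∀ i, ∫ x in K, (x - b) i * (x - b) i = σ ^ 2 * volume.real K) :
    volume.real K ≤
      2 * (√(2 * d) * σ) ^ d * volume.real (Metric.ball (0 : EuclideanSpace ℝ (Fin d)) 1) := by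
  have hint : ∀ g : EuclideanSpace ℝ (Fin d) → ℝ, Continuous g → IntegrableOn g K :=
    fun g hg => hg.continuousOn.integrableOn_compact hK
  have hd0 : (0 : ℝ) < d := by exact_mod_cast hd
  set R := √(2 * d) * σ with hR
  have hR0 : 0 < R := by positivity
  have hR2 : R ^ 2 = 2 * d * σ ^ 2 := by rw [hR, mul_pow, Real.sq_sqrt (by positivity)]
  have hnorm : ∫ x in K, ‖x - b‖ ^ 2 = d * (σ ^ 2 * volume.real K) := by
    have : ∀ x : EuclideanSpace ℝ (Fin d), ‖x - b‖ ^ 2 = ∑ i, (x - b) i * (x - b) i :=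
      fun x => by rw [EuclideanSpace.norm_sq_eq]; simp [sq]
    simp only [this]
    rw [integral_finsetSum _ fun i _ => hint _ (by fun_prop)]
    simp only [h2, Finset.sum_const, Finset.card_univ, Fintype.card_fin, nsmul_eq_mul]
  set B := Metric.closedBall b R with hB
  have hBm : MeasurableSet B := Metric.isClosed_closedBall.measurableSet
  have hout : R ^ 2 * volume.real (K \ B) ≤ d * (σ ^ 2 * volume.real K) := by
    rw [← hnorm]
    calc R ^ 2 * volume.real (K \ B) = ∫ x in K \ B, R ^ 2 := by simp [mul_comm]
      _ ≤ ∫ x in K \ B, ‖x - b‖ ^ 2 := by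
        refine setIntegral_mono_on ((hint (fun _ => R ^ 2) (by fun_prop)).mono_set Set.sdiff_subset)
          ((hint _ (by fun_prop)).mono_set Set.sdiff_subset) (hK.measurableSet.diff hBm) ?_
        intro x hx
        have : R < ‖x - b‖ := by
          by_contra h
          exact hx.2 (mem_closedBall_iff_norm.2 (not_lt.1 h))
        gcongr
      _ ≤ ∫ x in K, ‖x - b‖ ^ 2 :=
        setIntegral_mono_set (hint _ (by fun_prop)) (ae_of_all _ fun x => by positivity)
          Set.sdiff_subset.eventuallyLE
  have hhalf : volume.real (K \ B) ≤ volume.real K / 2 := by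
    rw [hR2] at hout
    have : (0 : ℝ) < 2 * d * σ ^ 2 := by positivity
    refine le_of_mul_le_mul_left (hout.trans_eq ?_) this
    ring
  have hBv : volume.real B = R ^ d * volume.real (Metric.ball (0 : EuclideanSpace ℝ (Fin d)) 1) := by
    rw [Measure.real, hB, Measure.addHaar_closedBall _ _ hR0.le, ENNReal.toReal_mul,
      finrank_euclideanSpace_fin, ENNReal.toReal_ofReal (by positivity), Measure.real]
  have hcover : volume.real K ≤ volume.real (K \ B) + volume.real B := by
    have hsub : K ⊆ (K \ B) ∪ B := by simp
    refine (measureReal_mono hsub ?_).trans (measureReal_union_le _ _)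
    exact (measure_union_lt_top (measure_lt_top_of_subset Set.sdiff_subset hK.measure_lt_top.ne)
      measure_closedBall_lt_top).ne
  rw [hBv] at hcover
  linarith

theorem ncard_inter_integerLattice {d : ℕ} (K : Set (EuclideanSpace ℝ (Fin d))) :
    (K ∩ integerLattice d).ncard = (intPoint ⁻¹' K).ncard := by
  rw [← Set.ncard_image_of_injective _ (intPoint_injective d), Set.image_preimage_eq_inter_range]
  congr 2
  ext x
  constructor
  · intro h
    choose z hz using h
    exact ⟨z, by ext i; exact (hz i).symm⟩
  · rintro ⟨z, rfl⟩ i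
    exact ⟨z i, rfl⟩

/-! ### Final estimate -/

theorem one_add_pow_sub_one_le {d : ℕ} {t T : ℝ} (ht : 0 ≤ t) (hT : d = 1 ∨ t ≤ T) :
    (1 + t) ^ d - 1 ≤ max 1 (d * (1 + T) ^ (d - 1)) * t := by
  rcases hT with rfl | hT
  · nlinarith [le_max_left 1 (((1 : ℕ) : ℝ) * (1 + T) ^ (1 - 1))]
  · calc (1 + t) ^ d - 1 = (∑ i ∈ Finset.range d, (1 + t) ^ i) * t := by
          rw [← geom_sum_mul]; ring
      _ ≤ (∑ i ∈ Finset.range d, (1 + T) ^ (d - 1)) * t := by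
        gcongr with i hi
        calc (1 + t) ^ i ≤ (1 + T) ^ i := by gcongr
          _ ≤ (1 + T) ^ (d - 1) := pow_le_pow_right₀ (by linarith)
            (Nat.le_sub_one_of_lt (Finset.mem_range.1 hi))
      _ = (d * (1 + T) ^ (d - 1)) * t := by simp
      _ ≤ _ := by gcongr; exact le_max_right _ _

theorem mainTheorem6 (d : ℕ) (hd : 1 ≤ d) (v₀ : ℝ) (hv₀ : 0 < v₀) :
    ∃ M : ℝ, 0 < M ∧
      ∀ K : ConvexBody (EuclideanSpace ℝ (Fin d)), IsIsotropicBody K →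
        (d = 1 ∨ v₀ ≤ volume.real (K : Set (EuclideanSpace ℝ (Fin d)))) →
        |(((K : Set (EuclideanSpace ℝ (Fin d))) ∩ integerLattice d).ncard : ℝ)
              / volume.real (K : Set (EuclideanSpace ℝ (Fin d))) - 1|
          ≤ M / volume.real (K : Set (EuclideanSpace ℝ (Fin d))) ^ ((1 : ℝ) / (d : ℝ)) := by
  have hd0 : (0 : ℝ) < d := by exact_mod_cast hd
  set ω := volume.real (Metric.ball (0 : EuclideanSpace ℝ (Fin d)) 1) with hω
  have hω0 : 0 < ω :=
    ENNReal.toReal_pos (Metric.measure_ball_pos _ _ one_pos).ne' measure_ball_lt_top.ne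
  -- the inradius `r` satisfies `√d / r ≤ C / |K| ^ (1 / d)`
  set C := √d * 2 ^ (d + 1) * ((2 * ω) ^ (1 / (d : ℝ)) * √(2 * d)) with hC
  have hC0 : 0 < C := by positivity
  set D := max 1 (d * (1 + C / v₀ ^ (1 / (d : ℝ))) ^ (d - 1)) with hD
  have hD0 : 0 < D := lt_max_of_lt_left one_pos
  have hDd : (d : ℝ) ≤ D := by
    refine le_trans ?_ (le_max_right _ _)
    exact le_mul_of_one_le_right hd0.le (one_le_pow₀ (le_add_of_nonneg_right (by positivity)))
  refine ⟨D * C, mul_pos hD0 hC0, fun K ⟨hint, hiso⟩ hvol => ?_⟩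
  have hK := K.isCompact
  set V := volume.real (K : Set (EuclideanSpace ℝ (Fin d))) with hVdef
  have hV : 0 < V :=
    ENNReal.toReal_pos (Measure.measure_pos_of_nonempty_interior _ hint).ne' hK.measure_lt_top.ne
  obtain ⟨b, σ, hσ, h1, h2⟩ := exists_centred_moments hK hV hiso
  have hball := closedBall_subset_of_moments hK K.convex hV hσ h1 h2
  have hVσ := volume_le_of_second_moments hd hK hσ fun i => by simpa using h2 i i
  set r := σ / 2 ^ (d + 1) with hr
  have hr0 : 0 < r := by positivity
  obtain ⟨hup, hlow⟩ := ncard_lattice_bounds hd K.convex hK hr0 hball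
  rw [ncard_inter_integerLattice]
  set N : ℝ := ((intPoint ⁻¹' (K : Set (EuclideanSpace ℝ (Fin d)))).ncard : ℝ)
  set t := √d / r with ht
  have ht0 : 0 < t := by positivity
  have hVroot : V ^ (1 / (d : ℝ)) ≤ (2 * ω) ^ (1 / (d : ℝ)) * (√(2 * d) * σ) := by
    calc V ^ (1 / (d : ℝ)) ≤ ((2 * ω) * (√(2 * d) * σ) ^ d) ^ (1 / (d : ℝ)) := by
          gcongr
          linarith
      _ = _ := by
          rw [Real.mul_rpow (by positivity) (by positivity), one_div,
            Real.pow_rpow_inv_natCast (by positivity) (by omega)]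
  have htC : t ≤ C / V ^ (1 / (d : ℝ)) := by
    rw [le_div_iff₀ (by positivity)]
    calc t * V ^ (1 / (d : ℝ)) ≤ t * ((2 * ω) ^ (1 / (d : ℝ)) * (√(2 * d) * σ)) := by gcongr
      _ = C := by rw [ht, hr, hC]; field_simp
  have htT : d = 1 ∨ t ≤ C / v₀ ^ (1 / (d : ℝ)) :=
    hvol.imp_right fun hv => htC.trans (by gcongr)
  have hmain : |N / V - 1| ≤ D * t := by
    rw [abs_le]
    constructor
    -- For `t ≤ 1`, Bernoulli's inequality gives the lower bound; for `t > 1`, `N / V ≥ 0` suffices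
    -- because `D ≥ 1`.
    · rcases le_or_gt (√d) r with h | h
      · have hb : 1 - d * t ≤ N / V := by
          rw [le_div_iff₀ hV]
          refine le_trans ?_ (hlow h)
          gcongr
          have := one_add_mul_le_pow (a := -t) (by
            have := (div_le_one hr0).2 h; linarith) d
          rw [← sub_eq_add_neg] at this
          linarith
        nlinarith
      · have h1t : 1 ≤ t := (one_le_div hr0).2 h.le
        have hN : 0 ≤ N / V := by positivity
        nlinarith [le_max_left 1 (d * (1 + C / v₀ ^ (1 / (d : ℝ))) ^ (d - 1))]
    · refine le_trans ?_ (one_add_pow_sub_one_le ht0.le htT)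
      gcongr
      exact (div_le_iff₀ hV).2 hup
  calc _ ≤ D * t := hmain
    _ ≤ D * (C / V ^ (1 / (d : ℝ))) := by gcongr
    _ = _ := by ring
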